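/- Let $K$ be a field of characteristic $0$ and let $\alpha,\beta,\gamma\in K$ be nonzero. Let $\mathbb M=\mathbb M(\alpha,\beta,\gamma)$ be the seven-dimensional simple Malcev algebra over $K$ with basis $f_1,\dots,f_7$ and the skew-symmetric bilinear product $[\,,]$ given by $$ \begin{aligned} &[f_1,f_2]=f_4, && [f_2,f_4]=\beta f_1, && [f_4,f_1]=\alpha f_2,\\ &[f_2,f_3]=f_5, && [f_3,f_5]=\gamma f_2, && [f_5,f_2]=\beta f_3,\\ &[f_3,f_4]=f_6, && [f_4,f_6]=\alpha\beta f_3, && [f_6,f_3]=\gamma f_4,\\ &[f_4,f_5]=\beta f_7, && [f_5,f_7]=\gamma f_4, && [f_7,f_4]=\alpha f_5,\\ &[f_5,f_6]=\beta\gamma f_1, && [f_6,f_1]=\alpha f_5, && [f_1,f_5]=f_6,\\ &[f_6,f_7]=\alpha\gamma f_2, && [f_7,f_2]=f_6, && [f_2,f_6]=\beta f_7,\\ &[f_7,f_1]=\alpha f_3, && [f_1,f_3]=f_7, && [f_3,f_7]=\gamma f_1. \end{aligned} $$ A generic Poisson algebra over $K$ is a commutative associative $K$-algebra $A$ with a skew-symmetric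 bilinear bracket $\{\,,\}$ such that $\{a,bc\}=\{a,b\}c+b\{a,c\}$ for all $a,b,c\in A$. The Poisson enveloping algebra $P(\mathbb M)$ is the polynomial algebra $K[f_1,\dots,f_7]$ with the unique bracket that makes it a generic Poisson algebra and satisfies $\{f_i,f_j\}=[f_i,f_j]$ for all $i,j$. Its standard Casimir element is $$c_{\mathbb M}=\beta\gamma f_1^2+\alpha\gamma f_2^2+\alpha\beta f_3^2+\gamma f_4^2+\alpha f_5^2+f_6^2+\beta f_7^2 ,$$ and it satisfies $\{c_{\mathbb M},a\}=0$ for all $a\in P(\mathbb M)$. Hence, for $\lambda\in K$, the ideal $(c_{\mathbb M}-\lambda)$ of the polynomial algebra is stable under the bracket, and $S=P(\mathbb M)/(c_{\mathbb M}-\lambda)$ is a generic Poisson algebra. Then for every $0\neq\lambda\in K$ the generic Poisson algebra $S$ is central and simple, that is: its center $\{z\in S : \{z,a\}=0 \text{ for all } a\in S\}$ is equal to $K\cdot 1$; and $S\neq 0$, and the only ideals $I$ of the commutative algebra $S$ with $\{S,I\}\subseteq I$ are $0$ and $S$. -/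

import Mathlib

open MvPolynomial

/-- A generic Poisson algebra structure on a commutative associative unital `K`-algebra `A`:
a skew-symmetric bilinear bracket that satisfies the Leibniz identity (the Jacobi identity is
not required). -/
structure GenericPoisson (K A : Type*) [Field K] [CommRing A] [Algebra K A] where
  /-- The bracket `{a, b}`. -/
  bracket : A →ₗ[K] A →ₗ[K] A
  bracket_self : ∀ a, bracket a a = 0
  leibniz : ∀ a b c, bracket a (b * c) = bracket a b * c + b * bracket a c

namespace GenericPoisson

section General

variable {K A : Type*} [Field K] [CommRing A] [Algebra K A]

theorem skew (P : GenericPoisson K A) (a b : A) : P.bracket a b = - P.bracket b a := by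
  have h := P.bracket_self (a + b)
  simp only [map_add, LinearMap.add_apply, P.bracket_self, zero_add, add_zero] at h
  exact eq_neg_of_add_eq_zero_right h

/-- An ideal of the generic Poisson algebra: an ideal `I` of the commutative algebra `A` with
`{A, I} ⊆ I`. -/
def IsPoissonIdeal (P : GenericPoisson K A) (I : Ideal A) : Prop :=
  ∀ a : A, ∀ x ∈ I, P.bracket a x ∈ I

/-- A generic Poisson algebra is simple if it is nonzero and has no ideals `I` with
`{A, I} ⊆ I` except `0` and `A`. -/
def IsSimple (P : GenericPoisson K A) : Prop :=
  Nontrivial A ∧ ∀ I : Ideal A, P.IsPoissonIdeal I → I = ⊥ ∨ I = ⊤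

/-- The center: the set of all `z` with `{z, a} = 0` for every `a`. -/
def center (P : GenericPoisson K A) : Set A :=
  {z | ∀ a, P.bracket z a = 0}

/-- A generic Poisson algebra is central over `K` if its center is `K` (that is, `K · 1`). -/
def IsCentral (P : GenericPoisson K A) : Prop :=
  P.center = Set.range (algebraMap K A)

/-- In characteristic zero, the center is also the intersection of the associative and the
commutative center of the nonassociative algebra `⟨A, {,}⟩`. -/
theorem mem_center_iff [CharZero K] (P : GenericPoisson K A) (z : A) :
    z ∈ P.center ↔
      (∀ a b,
        P.bracket (P.bracket z a) b - P.bracket z (P.bracket a b) = 0 ∧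
        P.bracket (P.bracket a z) b - P.bracket a (P.bracket z b) = 0 ∧
        P.bracket (P.bracket a b) z - P.bracket a (P.bracket b z) = 0) ∧
      ∀ a, P.bracket z a - P.bracket a z = 0 := by
  constructor
  · intro h
    have h' : ∀ a, P.bracket a z = 0 := fun a => by rw [P.skew, h a, neg_zero]
    have h'' : ∀ a, P.bracket z a = 0 := h
    simp [h', h'']
  · rintro ⟨-, h⟩ a
    have h1 := h a
    rw [P.skew a z, sub_neg_eq_add, ← two_smul K] at h1
    exact (smul_eq_zero.mp h1).resolve_left two_ne_zero

/-- A principal ideal generated by a central element is an ideal of the generic Poisson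
algebra. -/
theorem isPoissonIdeal_span_singleton (P : GenericPoisson K A) {z : A} (hz : z ∈ P.center) :
    P.IsPoissonIdeal (Ideal.span {z}) := by
  intro a x hx
  obtain ⟨y, rfl⟩ := Ideal.mem_span_singleton'.mp hx
  have h0 : P.bracket a z = 0 := by rw [P.skew, hz a, neg_zero]
  rw [P.leibniz, h0, mul_zero, add_zero]
  exact Ideal.mul_mem_left _ _ (Ideal.mem_span_singleton_self z)

theorem bracket_sub_mem (P : GenericPoisson K A) {I : Ideal A} (hI : P.IsPoissonIdeal I)
    {a a' b b' : A} (ha : a - a' ∈ I) (hb : b - b' ∈ I) :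
    P.bracket a b - P.bracket a' b' ∈ I := by
  have h1 : P.bracket a (b - b') ∈ I := hI _ _ hb
  have h2 : P.bracket b' (a - a') ∈ I := hI _ _ ha
  have h3 : P.bracket a b - P.bracket a' b' =
      P.bracket a (b - b') - P.bracket b' (a - a') := by
    rw [map_sub, map_sub, P.skew b' a, P.skew b' a']
    ring
  rw [h3]
  exact I.sub_mem h1 h2

/-- The quotient generic Poisson algebra `A / I`, with bracket `{a + I, b + I} = {a, b} + I`. -/
def quotient (P : GenericPoisson K A) (I : Ideal A) (hI : P.IsPoissonIdeal I) :
    GenericPoisson K (A ⧸ I) where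
  bracket := LinearMap.mk₂ K
    (fun x y => Quotient.liftOn₂' x y
      (fun a b => Ideal.Quotient.mk I (P.bracket a b))
      (fun a b a' b' ha hb => Ideal.Quotient.eq.mpr (P.bracket_sub_mem hI
        ((Submodule.quotientRel_def I).mp ha) ((Submodule.quotientRel_def I).mp hb))))
    (by
      rintro ⟨a⟩ ⟨b⟩ ⟨c⟩
      change Ideal.Quotient.mk I (P.bracket (a + b) c) = Ideal.Quotient.mk I (P.bracket a c) +
        Ideal.Quotient.mk I (P.bracket b c)
      simp)
    (by
      rintro k ⟨a⟩ ⟨b⟩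
      change Ideal.Quotient.mk I (P.bracket (k • a) b) = k • Ideal.Quotient.mk I (P.bracket a b)
      rw [map_smul, LinearMap.smul_apply]
      rfl)
    (by
      rintro ⟨a⟩ ⟨b⟩ ⟨c⟩
      change Ideal.Quotient.mk I (P.bracket a (b + c)) = Ideal.Quotient.mk I (P.bracket a b) +
        Ideal.Quotient.mk I (P.bracket a c)
      simp)
    (by
      rintro k ⟨a⟩ ⟨b⟩
      change Ideal.Quotient.mk I (P.bracket a (k • b)) = k • Ideal.Quotient.mk I (P.bracket a b)
      rw [map_smul]
      rfl)
  bracket_self := by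
    rintro ⟨a⟩
    change Ideal.Quotient.mk I (P.bracket a a) = 0
    rw [P.bracket_self, map_zero]
  leibniz := by
    rintro ⟨a⟩ ⟨b⟩ ⟨c⟩
    change Ideal.Quotient.mk I (P.bracket a (b * c)) =
      Ideal.Quotient.mk I (P.bracket a b) * Ideal.Quotient.mk I c +
        Ideal.Quotient.mk I b * Ideal.Quotient.mk I (P.bracket a c)
    rw [P.leibniz, map_add, map_mul, map_mul]

theorem quotient_bracket_mk (P : GenericPoisson K A) (I : Ideal A) (hI : P.IsPoissonIdeal I)
    (a b : A) :
    (P.quotient I hI).bracket (Ideal.Quotient.mk I a) (Ideal.Quotient.mk I b) =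
      Ideal.Quotient.mk I (P.bracket a b) :=
  rfl

end General

section Enveloping

variable {K L ι : Type*} [Field K] [AddCommGroup L] [Module K L] [Fintype ι]

/-- An element of `L`, as a linear polynomial in the elements `e i = X i` of the basis. -/
noncomputable def linPoly (e : Module.Basis ι K L) (v : L) : MvPolynomial ι K :=
  ∑ i, C (e.repr v i) * X i

/-- The bracket on `K[e₁, …, eₙ]` that satisfies the Leibniz identity and extends the product of
the algebra `⟨L, br⟩`:  `{f, g} = ∑ i j, (∂f/∂eᵢ) (∂g/∂eⱼ) [eᵢ, eⱼ]`. -/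
noncomputable def envBracket (br : L →ₗ[K] L →ₗ[K] L) (e : Module.Basis ι K L) :
    MvPolynomial ι K →ₗ[K] MvPolynomial ι K →ₗ[K] MvPolynomial ι K :=
  LinearMap.mk₂ K
    (fun f g => ∑ i, ∑ j, pderiv i f * pderiv j g * linPoly e (br (e i) (e j)))
    (by intros; simp [add_mul, Finset.sum_add_distrib])
    (by intros; simp [Finset.smul_sum])
    (by intros; simp [add_mul, mul_add, Finset.sum_add_distrib])
    (by intros; simp [Finset.smul_sum])

theorem envBracket_apply (br : L →ₗ[K] L →ₗ[K] L) (e : Module.Basis ι K L)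
    (f g : MvPolynomial ι K) :
    envBracket br e f g =
      ∑ i, ∑ j, pderiv i f * pderiv j g * linPoly e (br (e i) (e j)) :=
  rfl

theorem envBracket_X_X (br : L →ₗ[K] L →ₗ[K] L) (e : Module.Basis ι K L) (i j : ι) :
    envBracket br e (X i) (X j) = linPoly e (br (e i) (e j)) := by
  classical
  simp [envBracket_apply, pderiv_X, Pi.single_apply]

/-- The Poisson enveloping algebra `P(L)` of a finite-dimensional algebra `⟨L, br⟩` with a
skew-symmetric product `br` and basis `e`. -/
noncomputable def enveloping [CharZero K] (br : L →ₗ[K] L →ₗ[K] L) (hbr : br.IsAlt)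
    (e : Module.Basis ι K L) : GenericPoisson K (MvPolynomial ι K) where
  bracket := envBracket br e
  bracket_self f := by
    have h : envBracket br e f f = - envBracket br e f f := by
      conv_lhs => rw [envBracket_apply, Finset.sum_comm]
      rw [envBracket_apply, ← Finset.sum_neg_distrib]
      refine Finset.sum_congr rfl fun i _ => ?_
      rw [← Finset.sum_neg_distrib]
      refine Finset.sum_congr rfl fun j _ => ?_
      rw [← hbr.neg (e i) (e j)]
      simp only [linPoly, map_neg, Finsupp.neg_apply, neg_mul, Finset.sum_neg_distrib]
      ring
    exact self_eq_neg.mp h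
  leibniz f g h := by
    simp only [envBracket_apply, Finset.sum_mul, Finset.mul_sum, ← Finset.sum_add_distrib]
    refine Finset.sum_congr rfl fun i _ => Finset.sum_congr rfl fun j _ => ?_
    rw [Derivation.leibniz, smul_eq_mul, smul_eq_mul]
    ring

end Enveloping

end GenericPoisson

namespace Malcev

variable {K : Type*} [Field K]

/-- The product of the seven-dimensional algebra `𝕄(α, β, γ)` on `K⁷` in the coordinates of the
basis `f₁, …, f₇` (here `f₁ = Pi.single 0 1, …, f₇ = Pi.single 6 1`). With
`d i j = u i * v j - u j * v i`, it encodes the skew-symmetric multiplication table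

`[f₁,f₂] = f₄`, `[f₂,f₄] = β f₁`, `[f₄,f₁] = α f₂`,
`[f₂,f₃] = f₅`, `[f₃,f₅] = γ f₂`, `[f₅,f₂] = β f₃`,
`[f₃,f₄] = f₆`, `[f₄,f₆] = αβ f₃`, `[f₆,f₃] = γ f₄`,
`[f₄,f₅] = β f₇`, `[f₅,f₇] = γ f₄`, `[f₇,f₄] = α f₅`,
`[f₅,f₆] = βγ f₁`, `[f₆,f₁] = α f₅`, `[f₁,f₅] = f₆`,
`[f₆,f₇] = αγ f₂`, `[f₇,f₂] = f₆`, `[f₂,f₆] = β f₇`,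
`[f₇,f₁] = α f₃`, `[f₁,f₃] = f₇`, `[f₃,f₇] = γ f₁`,

obtained from `[eᵢ,eᵢ₊₁] = eᵢ₊₃`, `[eᵢ₊₁,eᵢ₊₃] = eᵢ`, `[eᵢ₊₃,eᵢ] = eᵢ₊₁` (indices mod 7) by the
formal substitution `f₁ = √α e₁`, `f₂ = √β e₂`, `f₃ = √γ e₃`, `f₄ = √(αβ) e₄`, `f₅ = √(βγ) e₅`,
`f₆ = √(αβγ) e₆`, `f₇ = √(αγ) e₇`. -/
def mulFun (α β γ : K) (u v : Fin 7 → K) : Fin 7 → K :=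
  let d : Fin 7 → Fin 7 → K := fun i j => u i * v j - u j * v i
  ![β * d 1 3 + β * γ * d 4 5 + γ * d 2 6,
    α * d 3 0 + γ * d 2 4 + α * γ * d 5 6,
    β * d 4 1 + α * β * d 3 5 + α * d 6 0,
    d 0 1 + γ * d 5 2 + γ * d 4 6,
    d 1 2 + α * d 6 3 + α * d 5 0,
    d 2 3 + d 0 4 + d 6 1,
    β * d 3 4 + β * d 1 5 + d 0 2]

/-- The product of `𝕄(α, β, γ)` as a bilinear map. -/
def mul (α β γ : K) : (Fin 7 → K) →ₗ[K] (Fin 7 → K) →ₗ[K] (Fin 7 → K) :=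
  LinearMap.mk₂ K (mulFun α β γ)
    (by intros; ext i; fin_cases i <;> simp [mulFun] <;> ring)
    (by intros; ext i; fin_cases i <;> simp [mulFun] <;> ring)
    (by intros; ext i; fin_cases i <;> simp [mulFun] <;> ring)
    (by intros; ext i; fin_cases i <;> simp [mulFun] <;> ring)

theorem mul_isAlt (α β γ : K) : (mul α β γ).IsAlt := by
  intro u
  ext i
  fin_cases i <;> simp [mul, mulFun, mul_comm]

/-- The Poisson enveloping algebra `P(𝕄)` of `𝕄 = 𝕄(α, β, γ)`, on the polynomial algebra in
`f₁ = X 0, …, f₇ = X 6`. -/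
noncomputable def poissonEnv [CharZero K] (α β γ : K) :
    GenericPoisson K (MvPolynomial (Fin 7) K) :=
  GenericPoisson.enveloping (mul α β γ) (mul_isAlt α β γ) (Pi.basisFun K (Fin 7))

/-- The standard Casimir element
`βγ f₁² + αγ f₂² + αβ f₃² + γ f₄² + α f₅² + f₆² + β f₇²` of `P(𝕄)`. -/
noncomputable def casimir (α β γ : K) : MvPolynomial (Fin 7) K :=
  C (β * γ) * X 0 ^ 2 + C (α * γ) * X 1 ^ 2 + C (α * β) * X 2 ^ 2 + C γ * X 3 ^ 2 +
    C α * X 4 ^ 2 + X 5 ^ 2 + C β * X 6 ^ 2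

theorem casimir_sub_mem_center [CharZero K] (α β γ lam : K) :
    casimir α β γ - C lam ∈ (poissonEnv α β γ).center := by
  intro g
  change GenericPoisson.envBracket _ _ _ _ = 0
  rw [GenericPoisson.envBracket_apply, Finset.sum_comm]
  refine Finset.sum_eq_zero fun j _ => ?_
  have key : ∑ i, pderiv i (casimir α β γ - C lam) * GenericPoisson.linPoly
      (Pi.basisFun K (Fin 7)) (mul α β γ (Pi.basisFun K (Fin 7) i)
        (Pi.basisFun K (Fin 7) j)) = 0 := by
    fin_cases j <;>
    · simp [Fin.sum_univ_seven, casimir, GenericPoisson.linPoly, mul, mulFun,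
        Derivation.leibniz, Derivation.leibniz_pow, pderiv_X, Pi.single_apply]
      try ring
  rw [← mul_zero (pderiv j g), ← key, Finset.mul_sum]
  exact Finset.sum_congr rfl fun i _ => by ring

/-- The quotient generic Poisson algebra `P(𝕄) / (c_𝕄 - lam)`, where `(c_𝕄 - lam)` is the ideal of
the polynomial algebra generated by `c_𝕄 - lam`. -/
noncomputable def casimirQuotient [CharZero K] (α β γ lam : K) :
    GenericPoisson K (MvPolynomial (Fin 7) K ⧸ Ideal.span {casimir α β γ - C lam}) :=
  (poissonEnv α β γ).quotient (Ideal.span {casimir α β γ - C lam})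
    ((poissonEnv α β γ).isPoissonIdeal_span_singleton (casimir_sub_mem_center α β γ lam))

end Malcev

/-! The Hamiltonian derivations of `S` yield the tangent derivations of the affine quadric `c_𝕄 =
λ`, and that quadric is smooth because λ ≠ 0. Write q for the coefficients of `c_𝕄`, d for the
complementary ones and E for the Euler derivation. The matrix of brackets satisfies ∑ᵢ qᵢ {f_k,
fᵢ}{fᵢ, f_j} = d_k (q_k f_k f_j − δ_kj c_𝕄), a form of the 7-dimensional cross product identity u ×
(u × v) = (u·v) u − |u|² v (`sum_bracket_mul_bracket_X`). Hence, modulo c_𝕄 − λ, the operator ∑ᵢ qᵢ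
{f_k, fᵢ}{fᵢ, ·} is −d_k T_k with T_k = λ ∂_k − q_k X_k E. So Poisson ideals are T_k-stable and
central elements are killed by every T_k (`tangent_mem`).

The rest concerns the quadric alone. Its coordinate ring is free with basis 1, X₀ over the
polynomials in the other variables, with q₀ X₀² = P, where P = `tailForm` is squarefree and not a
unit.

Simplicity: a nonzero stable ideal contains the norm q₀ a² − b² P ≠ 0 of some a + b X₀.
Differentiation lowers its degree at the cost of factors P, until a power of P, hence of X₀, is
reached; T₀ then lowers that power to 1 (`eq_span_or_eq_top`).

Centrality: T₀(a + b X₀) has X₀-coefficient −q₀ E a, so a is constant; the same argument for q₀ (b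
X₀)² = b² P makes b² P constant, and so b = 0. -/

namespace Quadric

/-! ### Euler derivation and degrees -/

variable {K : Type*} [Field K]

/-- The Euler derivation `∑ i, X i * ∂/∂X i`. -/
noncomputable def euler {σ : Type*} : Derivation K (MvPolynomial σ K) (MvPolynomial σ K) :=
  mkDerivation K X

theorem euler_X {σ : Type*} (i : σ) : euler (X i : MvPolynomial σ K) = X i :=
  mkDerivation_X _ _ _

theorem euler_C {σ : Type*} (a : K) : euler (C a : MvPolynomial σ K) = 0 :=
  euler.map_algebraMap a

theorem euler_apply {σ : Type*} [Fintype σ] (p : MvPolynomial σ K) :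
    euler p = ∑ i, X i * pderiv i p := by
  classical
  induction p using MvPolynomial.induction_on with
  | C a => simp
  | add p r hp hr => simp [hp, hr, mul_add, Finset.sum_add_distrib]
  | mul_X p j hp =>
    simp only [Derivation.leibniz, euler_X, hp, smul_eq_mul, mul_add, Finset.sum_add_distrib,
      pderiv_X, Pi.single_apply, Finset.mul_sum]
    congr 1
    · simp [mul_comm]
    · exact Finset.sum_congr rfl fun i _ => by ring

theorem euler_rename {σ τ : Type*} (f : σ → τ) (p : MvPolynomial σ K) :
    euler (rename f p) = rename f (euler p) := by
  induction p using MvPolynomial.induction_on with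
  | C a => simp
  | add p r hp hr => simp [hp, hr]
  | mul_X p j hp => simp [Derivation.leibniz, euler_X, hp]

theorem coeff_euler {σ : Type*} [Fintype σ] (p : MvPolynomial σ K) (m : σ →₀ ℕ) :
    coeff m (euler p) = m.degree * coeff m p := by
  classical
  induction p using MvPolynomial.induction_on' with
  | monomial a b =>
    rw [euler_apply]
    simp only [X_mul_pderiv_monomial, ← Finset.sum_smul, coeff_smul, coeff_monomial]
    split_ifs with h
    · subst h
      simp [Finsupp.degree_eq_sum]
    · simp
  | add p r hp hr => rw [map_add, coeff_add, coeff_add, hp, hr, mul_add]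

/-- E scales each monomial by its degree, which is invertible in characteristic 0 unless the
monomial is constant. -/
theorem eq_C_of_euler_eq_zero {σ : Type*} [Fintype σ] [CharZero K] {p : MvPolynomial σ K}
    (h : euler p = 0) : p = C (coeff 0 p) := by
  classical
  ext m
  rw [coeff_C]
  split_ifs with hm
  · rw [← hm]
  · have h1 := coeff_euler p m
    rw [h, coeff_zero] at h1
    refine (mul_eq_zero.mp h1.symm).resolve_left ?_
    rw [Nat.cast_eq_zero, Finsupp.degree_eq_zero_iff]
    exact fun h => hm h.symm

theorem totalDegree_pderiv_lt {σ : Type*} {i : σ} {p : MvPolynomial σ K}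
    (h : pderiv i p ≠ 0) : (pderiv i p).totalDegree < p.totalDegree := by
  classical
  have key : ∀ m ∈ (pderiv i p).support, m.degree + 1 ≤ p.totalDegree := by
    intro m hm
    rw [mem_support_iff, coeff_pderiv] at hm
    have h1 := le_totalDegree (mem_support_iff.mpr (left_ne_zero_of_mul hm))
    have h2 : ((m + Finsupp.single i 1).sum fun _ e => e) = m.degree + 1 := by
      change (m + Finsupp.single i 1).degree = _
      rw [map_add, Finsupp.degree_single]
    rwa [h2] at h1
  obtain ⟨m, hm⟩ := support_nonempty.mpr h
  refine (Finset.sup_lt_iff ?_).mpr fun m hm => key m hm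
  exact lt_of_lt_of_le (Nat.succ_pos _) (key m hm)

/-! ### Quadrics and normal forms a + b X₀ -/

variable {n : ℕ}

/-- The diagonal quadratic form `∑ i, q i * X i ^ 2`. -/
noncomputable def form (q : Fin n → K) : MvPolynomial (Fin n) K :=
  ∑ i, C (q i) * X i ^ 2

/-- The derivation `lam * ∂/∂X k - q k * X k * E`, which is tangent to the quadric
`form q = lam`. -/
noncomputable def tangent (q : Fin n → K) (lam : K) (k : Fin n) :
    Derivation K (MvPolynomial (Fin n) K) (MvPolynomial (Fin n) K) :=
  (C lam : MvPolynomial (Fin n) K) • pderiv k - (C (q k) * X k) • euler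

theorem tangent_apply (q : Fin n → K) (lam : K) (k : Fin n) (p : MvPolynomial (Fin n) K) :
    tangent q lam k p = C lam * pderiv k p - C (q k) * X k * euler p := rfl

/-- `lam - form q` with the first coefficient of `q` dropped. -/
noncomputable def tailForm (q : Fin (n + 1) → K) (lam : K) : MvPolynomial (Fin n) K :=
  C lam - form fun i => q i.succ

/-- The embedding of polynomials in all variables but the first one. -/
noncomputable def tailMap : MvPolynomial (Fin n) K →ₐ[K] MvPolynomial (Fin (n + 1)) K :=
  rename Fin.succ

theorem form_sub_C (q : Fin (n + 1) → K) (lam : K) :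
    form q - C lam = C (q 0) * X 0 ^ 2 - tailMap (tailForm q lam) := by
  simp only [form, tailForm, tailMap, Fin.sum_univ_succ, map_sub, map_sum, map_mul, map_pow,
    rename_C, rename_X]
  ring

theorem euler_tailMap (p : MvPolynomial (Fin n) K) : euler (tailMap p) = tailMap (euler p) :=
  euler_rename _ _

theorem pderiv_succ_tailMap (p : MvPolynomial (Fin n) K) (i : Fin n) :
    pderiv i.succ (tailMap p) = tailMap (pderiv i p) :=
  pderiv_rename (Fin.succ_injective n) i p

theorem pderiv_zero_tailMap (p : MvPolynomial (Fin n) K) : pderiv 0 (tailMap p) = 0 := by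
  refine pderiv_eq_zero_of_notMem_vars fun h => ?_
  classical
  obtain ⟨i, -, hi⟩ := Finset.mem_image.mp (vars_rename Fin.succ p h)
  exact Fin.succ_ne_zero i hi

theorem finSuccEquiv_tailMap (p : MvPolynomial (Fin n) K) :
    finSuccEquiv K n (tailMap p) = Polynomial.C p := by
  induction p using MvPolynomial.induction_on with
  | C a => simp [tailMap, finSuccEquiv_apply]
  | add p r hp hr => simp [hp, hr]
  | mul_X p j hp =>
    rw [map_mul, map_mul, hp, Polynomial.C_mul]
    congr 1
    rw [tailMap, rename_X, finSuccEquiv_X_succ]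

/-- Existence half of freeness over the tail variables: every X₀² is replaced by q₀⁻¹ P. -/
theorem exists_normal_form {q : Fin (n + 1) → K} (h0 : q 0 ≠ 0) (lam : K)
    (f : MvPolynomial (Fin (n + 1)) K) :
    ∃ a b, f - (tailMap a + tailMap b * X 0) ∈ Ideal.span {form q - C lam} := by
  set I := Ideal.span {form q - C lam} with hI
  induction f using MvPolynomial.induction_on with
  | C a => exact ⟨C a, 0, by simp [tailMap]⟩
  | add p r hp hr =>
    obtain ⟨a, b, h⟩ := hp
    obtain ⟨a', b', h'⟩ := hr
    refine ⟨a + a', b + b', ?_⟩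
    convert I.add_mem h h' using 1
    rw [map_add, map_add]
    ring
  | mul_X p j hp =>
    obtain ⟨a, b, h⟩ := hp
    have h1 := I.mul_mem_right (X j) h
    induction j using Fin.cases with
    | succ j =>
      refine ⟨a * X j, b * X j, ?_⟩
      convert h1 using 1
      simp only [map_mul, tailMap, rename_X]
      ring
    | zero =>
      -- (a + b X₀) X₀ = a X₀ + b X₀², and X₀² ≡ q₀⁻¹ P.
      refine ⟨C (q 0)⁻¹ * b * tailForm q lam, a, ?_⟩
      have h2 : form q - C lam ∈ I := Ideal.mem_span_singleton_self _
      convert I.add_mem h1 (I.mul_mem_left (C (q 0)⁻¹ * tailMap b) h2) using 1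
      have h3 : (C (q 0)⁻¹ * C (q 0) : MvPolynomial (Fin (n + 1)) K) = 1 := by
        rw [← C_mul, inv_mul_cancel₀ h0, C_1]
      have h4 : tailMap (C (q 0)⁻¹ : MvPolynomial (Fin n) K) = C (q 0)⁻¹ := by simp [tailMap]
      rw [form_sub_C, map_mul, map_mul, h4]
      linear_combination (-tailMap b * X 0 ^ 2) * h3

/-- Uniqueness half: as a polynomial in X₀ over a domain, the generator has degree 2, so it has no
nonzero multiple of degree less than 2. -/
theorem eq_zero_of_normal_form_mem {q : Fin (n + 1) → K} (h0 : q 0 ≠ 0) {lam : K}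
    {a b : MvPolynomial (Fin n) K}
    (h : tailMap a + tailMap b * X 0 ∈ Ideal.span {form q - C lam}) : a = 0 ∧ b = 0 := by
  obtain ⟨r, hr⟩ := Ideal.mem_span_singleton'.mp h
  have h1 := congrArg (finSuccEquiv K n) hr
  rw [form_sub_C] at h1
  simp only [map_mul, map_sub, map_add, map_pow, finSuccEquiv_tailMap, finSuccEquiv_X_zero] at h1
  have hC : finSuccEquiv K n (C (q 0)) = Polynomial.C (C (q 0)) := by simp [finSuccEquiv_apply]
  rw [hC] at h1
  set g := Polynomial.C (C (q 0)) * Polynomial.X ^ 2 - Polynomial.C (tailForm q lam) with hg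
  have hq : (C (q 0) : MvPolynomial (Fin n) K) ≠ 0 := by simpa using h0
  have hdeg : g.natDegree = 2 := by rw [hg]; compute_degree!
  have hdeg' : (Polynomial.C a + Polynomial.C b * Polynomial.X).natDegree < 2 := by
    rw [add_comm]; exact lt_of_le_of_lt (Polynomial.natDegree_linear_le) one_lt_two
  have hz : Polynomial.C a + Polynomial.C b * Polynomial.X = 0 := by
    by_contra hne
    have hr0 : finSuccEquiv K n r ≠ 0 := by
      intro h; rw [h, zero_mul] at h1; exact hne h1.symm
    have hg0 : g ≠ 0 := by
      intro h; rw [h, Polynomial.natDegree_zero] at hdeg; omega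
    have := Polynomial.natDegree_mul hr0 hg0
    rw [h1] at this
    omega
  constructor
  · simpa using congrArg (Polynomial.coeff · 0) hz
  · simpa [Polynomial.coeff_C] using congrArg (Polynomial.coeff · 1) hz

/-! ### Arithmetic of P = `tailForm` -/

theorem euler_form (q : Fin n → K) : euler (form q) = 2 * form q := by
  simp only [form, map_sum, Derivation.leibniz, Derivation.leibniz_pow, euler_C, euler_X,
    Finset.mul_sum, smul_eq_mul, nsmul_eq_mul]
  exact Finset.sum_congr rfl fun i _ => by push_cast; ring

theorem pderiv_form (q : Fin n → K) (k : Fin n) : pderiv k (form q) = 2 * C (q k) * X k := by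
  classical
  simp only [form, map_sum, Derivation.leibniz, Derivation.leibniz_pow, pderiv_C, pderiv_X,
    smul_eq_mul, nsmul_eq_mul, Pi.single_apply]
  simp
  ring

theorem euler_tailForm (q : Fin (n + 1) → K) (lam : K) :
    euler (tailForm q lam) = 2 * tailForm q lam - C (2 * lam) := by
  rw [tailForm, map_sub, euler_C, euler_form, C_mul, map_ofNat]
  ring

theorem tailForm_ne_zero [CharZero K] (q : Fin (n + 1) → K) {lam : K} (hlam : lam ≠ 0) :
    tailForm q lam ≠ 0 := by
  intro h
  have h1 := euler_tailForm q lam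
  rw [h, map_zero, mul_zero, zero_sub, eq_comm, neg_eq_zero, C_eq_zero] at h1
  exact mul_ne_zero two_ne_zero hlam h1

/-- Since 2P − E P = 2λ, a factor g with g² ∣ P divides both P and E P, hence the unit 2λ. -/
theorem squarefree_tailForm [CharZero K] (q : Fin (n + 1) → K) {lam : K} (hlam : lam ≠ 0) :
    Squarefree (tailForm q lam) := by
  rintro g ⟨r, hr⟩
  have h1 := euler_tailForm q lam
  have hu : IsUnit (C (2 * lam) : MvPolynomial (Fin n) K) :=
    (IsUnit.mk0 _ (mul_ne_zero two_ne_zero hlam)).map C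
  refine isUnit_of_dvd_unit ?_ hu
  have h2 : C (2 * lam) = 2 * tailForm q lam - euler (tailForm q lam) := by rw [h1]; ring
  rw [h2, hr]
  simp only [Derivation.leibniz, smul_eq_mul]
  exact ⟨2 * g * r - (g * euler r + 2 * r * euler g), by ring⟩

theorem not_isUnit_tailForm [CharZero K] [Nonempty (Fin n)] {q : Fin (n + 1) → K}
    (hq : ∀ i, q i ≠ 0) (lam : K) : ¬ IsUnit (tailForm q lam) := by
  intro h
  obtain ⟨a, -, ha⟩ := MvPolynomial.isUnit_iff_eq_C_of_isReduced.mp h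
  let i : Fin n := Classical.arbitrary _
  have h1 : pderiv i (tailForm q lam) = 0 := by rw [ha, pderiv_C]
  rw [tailForm, map_sub, pderiv_C, pderiv_form, zero_sub, neg_eq_zero] at h1
  have h2 : (C (2 * q i.succ) * X i : MvPolynomial (Fin n) K) ≠ 0 :=
    mul_ne_zero (by simpa using hq i.succ) (X_ne_zero i)
  apply h2
  rw [← h1, C_mul, map_ofNat]

/-- P is not a square up to units: once a and b are made coprime, squarefreeness forces P to divide
a and then b, although P is not a unit. -/
theorem eq_zero_of_norm_eq_zero [CharZero K] [Nonempty (Fin n)] {q : Fin (n + 1) → K}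
    (hq : ∀ i, q i ≠ 0) {lam : K} (hlam : lam ≠ 0) {a b : MvPolynomial (Fin n) K}
    (h : C (q 0) * a ^ 2 = b ^ 2 * tailForm q lam) : a = 0 ∧ b = 0 := by
  have hu : IsUnit (C (q 0) : MvPolynomial (Fin n) K) := (IsUnit.mk0 _ (hq 0)).map C
  have hsq := squarefree_tailForm q hlam
  have hP := tailForm_ne_zero q hlam
  by_cases ha : a = 0
  · subst ha
    have : b ^ 2 * tailForm q lam = 0 := by rw [← h]; ring
    exact ⟨rfl, by simpa [hP] using this⟩
  exfalso
  obtain ⟨a', b', d, hrel, rfl, rfl⟩ :=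
    UniqueFactorizationMonoid.exists_reduced_factors a ha b
  have hd : d ≠ 0 := left_ne_zero_of_mul ha
  have h1 : C (q 0) * a' ^ 2 = b' ^ 2 * tailForm q lam := by
    apply mul_left_cancel₀ (pow_ne_zero 2 hd)
    linear_combination h
  have hPa : tailForm q lam ∣ a' := by
    rw [← hsq.dvd_pow_iff_dvd two_ne_zero, ← hu.dvd_mul_left, h1]
    exact dvd_mul_left _ _
  have hPb : tailForm q lam ∣ b' := by
    rw [← hsq.dvd_pow_iff_dvd two_ne_zero]
    obtain ⟨r, hr⟩ := hPa
    refine ⟨C (q 0) * r ^ 2, mul_right_cancel₀ hP ?_⟩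
    rw [← h1, hr]
    ring
  exact not_isUnit_tailForm hq lam (hrel hPa hPb)

end Quadric

/-! ### Ideals stable under the tangent derivations -/

namespace Quadric

variable {K : Type*} [Field K]
variable {n : ℕ}

theorem mem_of_C_mul_mem {σ : Type*} {J : Ideal (MvPolynomial σ K)} {a : K} (ha : a ≠ 0)
    {f : MvPolynomial σ K} (h : C a * f ∈ J) : f ∈ J := by
  have h1 := J.mul_mem_left (C a⁻¹) h
  rwa [← mul_assoc, ← C_mul, inv_mul_cancel₀ ha, C_1, one_mul] at h1

section Stable

variable {q : Fin (n + 1) → K} {lam : K} {J : Ideal (MvPolynomial (Fin (n + 1)) K)}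

/-- Multiplying a + b X₀ ∈ J by q₀ times its conjugate a − b X₀ eliminates X₀; the resulting norm
vanishes only for a = b = 0. -/
theorem exists_tailMap_mem [CharZero K] [Nonempty (Fin n)] (hq : ∀ i, q i ≠ 0) (hlam : lam ≠ 0)
    (hF : form q - C lam ∈ J) (hne : J ≠ Ideal.span {form q - C lam}) :
    ∃ p : MvPolynomial (Fin n) K, p ≠ 0 ∧ tailMap p ∈ J := by
  have hIJ : Ideal.span {form q - C lam} ≤ J := (Ideal.span_singleton_le_iff_mem J).mpr hF
  obtain ⟨f, hfJ, hfI⟩ := SetLike.exists_of_lt (lt_of_le_of_ne hIJ hne.symm)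
  obtain ⟨a, b, hab⟩ := exists_normal_form (hq 0) lam f
  refine ⟨C (q 0) * a ^ 2 - b ^ 2 * tailForm q lam, ?_, ?_⟩
  · intro h
    obtain ⟨rfl, rfl⟩ := eq_zero_of_norm_eq_zero hq hlam (sub_eq_zero.mp h)
    simp only [map_zero, zero_mul, add_zero, sub_zero] at hab
    exact hfI hab
  · have h1 : tailMap a + tailMap b * X 0 ∈ J := by
      have := J.sub_mem hfJ (hIJ hab)
      rwa [sub_sub_cancel] at this
    convert J.add_mem (J.mul_mem_right (C (q 0) * (tailMap a - tailMap b * X 0)) h1)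
      (J.mul_mem_left (tailMap b ^ 2) hF) using 1
    have h4 : tailMap (C (q 0) : MvPolynomial (Fin n) K) = C (q 0) := by simp [tailMap]
    rw [form_sub_C, map_sub, map_mul, map_mul, map_pow, map_pow, h4]
    ring

/-- T₀ p = −q₀ X₀ E p because p does not involve X₀; multiplying by −X₀ puts P · E p in J. This
cancels the Euler term of P · T_k p and leaves λ P ∂_k p. -/
theorem tailMap_mul_pderiv_mem (hlam : lam ≠ 0) (hF : form q - C lam ∈ J)
    (hJ : ∀ k, ∀ g ∈ J, tangent q lam k g ∈ J) {p : MvPolynomial (Fin n) K}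
    (hp : tailMap p ∈ J) (k : Fin n) : tailMap (tailForm q lam * pderiv k p) ∈ J := by
  have h1 : tailMap (tailForm q lam * euler p) ∈ J := by
    have h2 := hJ 0 _ hp
    rw [tangent_apply, pderiv_zero_tailMap, euler_tailMap] at h2
    convert J.sub_mem (J.mul_mem_left (-X 0) h2) (J.mul_mem_left (tailMap (euler p)) hF) using 1
    rw [form_sub_C, map_mul]
    ring
  have h2 := hJ k.succ _ hp
  rw [tangent_apply, pderiv_succ_tailMap, euler_tailMap] at h2
  refine mem_of_C_mul_mem hlam ?_
  convert J.add_mem (J.mul_mem_left (tailMap (tailForm q lam)) h2)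
    (J.mul_mem_left (C (q k.succ) * X k.succ) h1) using 1
  rw [map_mul, map_mul]
  ring

theorem tailMap_pow_mul_pderiv_mem (hlam : lam ≠ 0) (hF : form q - C lam ∈ J)
    (hJ : ∀ k, ∀ g ∈ J, tangent q lam k g ∈ J) {p : MvPolynomial (Fin n) K} {m : ℕ}
    (hp : tailMap (tailForm q lam ^ m * p) ∈ J) (k : Fin n) :
    tailMap (tailForm q lam ^ (m + 1) * pderiv k p) ∈ J := by
  have h1 := tailMap_mul_pderiv_mem hlam hF hJ hp k
  -- P ∂(Pᵐ p) − m ∂P · Pᵐ p = Pᵐ⁺¹ ∂p.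
  convert J.sub_mem h1 (J.mul_mem_left (tailMap (m * pderiv k (tailForm q lam))) hp) using 1
  rw [← map_mul, ← map_sub]
  congr 1
  simp only [Derivation.leibniz, Derivation.leibniz_pow, smul_eq_mul, nsmul_eq_mul]
  cases m with
  | zero => simp
  | succ m =>
    rw [Nat.add_sub_cancel]
    ring

/-- Each derivative lowers the degree of p and raises the exponent of P by one; the descent ends at
a nonzero constant p. -/
theorem exists_tailMap_pow_mem [CharZero K] (hlam : lam ≠ 0) (hF : form q - C lam ∈ J)
    (hJ : ∀ k, ∀ g ∈ J, tangent q lam k g ∈ J) {p : MvPolynomial (Fin n) K} (hp0 : p ≠ 0)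
    {m : ℕ} (hp : tailMap (tailForm q lam ^ m * p) ∈ J) :
    ∃ m, tailMap (tailForm q lam ^ m) ∈ J := by
  induction hd : p.totalDegree using Nat.strong_induction_on generalizing p m with
  | _ d ih =>
    by_cases hc : ∀ k, pderiv k p = 0
    · have h1 : p = C (coeff 0 p) :=
        eq_C_of_euler_eq_zero (by rw [euler_apply]; simp [hc])
      have h2 : coeff 0 p ≠ 0 := by
        intro h; rw [h, C_0] at h1; exact hp0 h1
      refine ⟨m, mem_of_C_mul_mem h2 ?_⟩
      rw [h1, map_mul, mul_comm] at hp
      simpa [tailMap] using hp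
    · push Not at hc
      obtain ⟨k, hk⟩ := hc
      exact ih _ (hd ▸ totalDegree_pderiv_lt hk) hk
        (tailMap_pow_mul_pderiv_mem hlam hF hJ hp k) rfl

theorem one_mem_of_X_pow_mem [CharZero K] (hlam : lam ≠ 0) (hJ : ∀ k, ∀ g ∈ J, tangent q lam k g ∈ J)
    {m : ℕ} (h : X 0 ^ m ∈ J) : (1 : MvPolynomial (Fin (n + 1)) K) ∈ J := by
  induction m with
  | zero => simpa using h
  | succ m ih =>
    apply ih
    have h1 := hJ 0 _ h
    -- T₀ lowers the exponent of X₀: its Euler term is again a multiple of X₀ᵐ⁺¹.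
    have h2 : (C (lam * (m + 1)) : MvPolynomial (Fin (n + 1)) K) * X 0 ^ m =
        tangent q lam 0 (X 0 ^ (m + 1)) + C (q 0 * (m + 1)) * X 0 * X 0 ^ (m + 1) := by
      rw [tangent_apply, Derivation.leibniz_pow, Derivation.leibniz_pow, euler_X, pderiv_X_self]
      simp only [smul_eq_mul, nsmul_eq_mul, C_mul, C_add, C_1, map_natCast, Nat.add_sub_cancel]
      push_cast
      ring
    refine mem_of_C_mul_mem (mul_ne_zero hlam (Nat.cast_add_one_ne_zero m)) ?_
    rw [h2]
    exact J.add_mem h1 (J.mul_mem_left _ h)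

/-- The coordinate ring of a smooth quadric `form q = lam` of positive dimension has no proper
nonzero ideals that are stable under the tangent derivations. -/
theorem eq_span_or_eq_top [CharZero K] [Nonempty (Fin n)] (hq : ∀ i, q i ≠ 0) (hlam : lam ≠ 0)
    (hF : form q - C lam ∈ J) (hJ : ∀ k, ∀ g ∈ J, tangent q lam k g ∈ J) :
    J = Ideal.span {form q - C lam} ∨ J = ⊤ := by
  refine or_iff_not_imp_left.mpr fun hne => ?_
  obtain ⟨p, hp0, hp⟩ := exists_tailMap_mem hq hlam hF hne
  obtain ⟨m, hm⟩ := exists_tailMap_pow_mem (m := 0) hlam hF hJ hp0 (by simpa using hp)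
  -- The exponent is 2m because Pᵐ ≡ q₀ᵐ X₀²ᵐ modulo J.
  refine (Ideal.eq_top_iff_one J).mpr (one_mem_of_X_pow_mem (m := 2 * m) hlam hJ ?_)
  have h1 : tailMap (tailForm q lam) = C (q 0) * X 0 ^ 2 - (form q - C lam) := by
    rw [form_sub_C]; ring
  refine mem_of_C_mul_mem (pow_ne_zero m (hq 0)) ?_
  have h2 : (C (q 0) * X 0 ^ 2) ^ m - tailMap (tailForm q lam) ^ m ∈ J := by
    refine J.mem_of_dvd (sub_dvd_pow_sub_pow _ _ m) ?_
    rwa [h1, sub_sub_cancel]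
  rw [map_pow] at hm
  convert J.add_mem h2 hm using 1
  rw [C_pow, pow_mul]
  ring

end Stable

/-! ### Functions killed by T₀ -/

section Center

variable {q : Fin (n + 1) → K} {lam : K}

/-- Tangency: T_k(form − λ) = −2 q_k X_k (form − λ). -/
theorem tangent_mem_span {f : MvPolynomial (Fin (n + 1)) K}
    (hf : f ∈ Ideal.span {form q - C lam}) (k : Fin (n + 1)) :
    tangent q lam k f ∈ Ideal.span {form q - C lam} := by
  obtain ⟨r, rfl⟩ := Ideal.mem_span_singleton'.mp hf
  refine Ideal.mem_span_singleton'.mpr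
    ⟨tangent q lam k r - r * (2 * C (q k) * X k), ?_⟩
  rw [Derivation.leibniz, smul_eq_mul, smul_eq_mul, tangent_apply q lam k (form q - C lam),
    map_sub, map_sub, euler_C, pderiv_C, euler_form, pderiv_form]
  ring

theorem euler_eq_zero_of_tangent_mem (h0 : q 0 ≠ 0) {a b : MvPolynomial (Fin n) K}
    (h : tangent q lam 0 (tailMap a + tailMap b * X 0) ∈ Ideal.span {form q - C lam}) :
    euler a = 0 := by
  set I := Ideal.span {form q - C lam} with hI
  have hF : form q - C lam ∈ I := Ideal.mem_span_singleton_self _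
  -- Adding this multiple of the generator replaces q₀ X₀² (E b + b) by P (E b + b), which brings
  -- T₀(a + b X₀) into normal form.
  have h1 := I.add_mem h (I.mul_mem_left (tailMap (euler b + b)) hF)
  have hC : ∀ x : K, tailMap (C x : MvPolynomial (Fin n) K) = C x := by simp [tailMap]
  have h2 : tangent q lam 0 (tailMap a + tailMap b * X 0) +
      tailMap (euler b + b) * (form q - C lam) =
      tailMap (C lam * b - tailForm q lam * (euler b + b)) +
        tailMap (C (-q 0) * euler a) * X 0 := by
    simp only [tangent_apply, map_add, Derivation.leibniz, pderiv_zero_tailMap, pderiv_X_self,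
      euler_X, euler_tailMap, form_sub_C, map_mul, map_sub, hC, smul_eq_mul, map_neg]
    ring
  rw [h2] at h1
  have h3 := (eq_zero_of_normal_form_mem h0 h1).2
  exact (mul_eq_zero.mp h3).resolve_left (by simpa using h0)

/-- A function on a smooth quadric of positive dimension that is killed by the first tangent
derivation is constant. -/
theorem exists_sub_C_mem_of_tangent_mem [CharZero K] [Nonempty (Fin n)] (hq : ∀ i, q i ≠ 0)
    (hlam : lam ≠ 0) {z : MvPolynomial (Fin (n + 1)) K}
    (hz : tangent q lam 0 z ∈ Ideal.span {form q - C lam}) :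
    ∃ t, z - C t ∈ Ideal.span {form q - C lam} := by
  obtain ⟨a, b, hab⟩ := exists_normal_form (hq 0) lam z
  set I := Ideal.span {form q - C lam} with hI
  have hF : form q - C lam ∈ I := Ideal.mem_span_singleton_self _
  have h1 : tangent q lam 0 (tailMap a + tailMap b * X 0) ∈ I := by
    have := I.sub_mem hz (tangent_mem_span hab 0)
    rwa [← map_sub, sub_sub_cancel] at this
  have ha := eq_C_of_euler_eq_zero (euler_eq_zero_of_tangent_mem (hq 0) h1)
  have hac : tailMap a = C (coeff 0 a) := by rw [ha]; simp [tailMap]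
  have hb : b = 0 := by
    have h2 : tangent q lam 0 (tailMap b * X 0) ∈ I := by
      have h3 : tangent q lam 0 (C (coeff 0 a)) = 0 := (tangent q lam 0).map_algebraMap _
      rwa [map_add, hac, h3, zero_add] at h1
    -- Squaring moves b X₀ into the tail ring, as q₀ (b X₀)² ≡ b² P, so the Euler criterion applies
    -- again.
    have h3 : tangent q lam 0 (C (q 0) * (tailMap b * X 0) ^ 2) ∈ I := by
      have h5 : tangent q lam 0 (C (q 0)) = 0 := (tangent q lam 0).map_algebraMap _
      rw [Derivation.leibniz, h5, smul_zero, add_zero, Derivation.leibniz_pow, smul_eq_mul,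
        smul_eq_mul, nsmul_eq_mul]
      exact I.mul_mem_left _ (I.mul_mem_left _ (I.mul_mem_left _ h2))
    have h4 : tangent q lam 0 (tailMap (b ^ 2 * tailForm q lam) + tailMap 0 * X 0) ∈ I := by
      have h5 := I.sub_mem h3 (tangent_mem_span (I.mul_mem_left (tailMap b ^ 2) hF) 0)
      rw [← map_sub] at h5
      convert h5 using 2
      rw [form_sub_C, map_mul, map_pow, map_zero]
      ring
    have h5 := eq_C_of_euler_eq_zero (euler_eq_zero_of_tangent_mem (hq 0) h4)
    by_contra hb0
    -- A constant b² P with b ≠ 0 is impossible: zero contradicts P ≠ 0, nonzero makes P a unit.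
    by_cases hs : coeff 0 (b ^ 2 * tailForm q lam) = 0
    · rw [hs, C_0] at h5
      exact mul_ne_zero (pow_ne_zero 2 hb0) (tailForm_ne_zero q hlam) h5
    · refine not_isUnit_tailForm hq lam (isUnit_of_dvd_unit (Dvd.intro_left _ h5) ?_)
      exact (IsUnit.mk0 _ hs).map C
  refine ⟨coeff 0 a, ?_⟩
  rw [← hac]
  simpa [hb] using hab

end Center

end Quadric

/-! ### From brackets of `P(𝕄)` to tangent derivations -/

namespace Malcev

variable {K : Type*} [Field K]

/-- The coefficients of the Casimir element. -/
def casimirCoeff (α β γ : K) : Fin 7 → K :=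
  ![β * γ, α * γ, α * β, γ, α, 1, β]

/-- The complementary coefficients: `casimirCoeff i * casimirDualCoeff i = α * β * γ`. -/
def casimirDualCoeff (α β γ : K) : Fin 7 → K :=
  ![α, β, γ, α * β, β * γ, α * β * γ, α * γ]

theorem casimirCoeff_ne_zero {α β γ : K} (hα : α ≠ 0) (hβ : β ≠ 0) (hγ : γ ≠ 0) (i : Fin 7) :
    casimirCoeff α β γ i ≠ 0 := by
  fin_cases i <;> simp [casimirCoeff, hα, hβ, hγ]

theorem casimirDualCoeff_ne_zero {α β γ : K} (hα : α ≠ 0) (hβ : β ≠ 0) (hγ : γ ≠ 0)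
    (i : Fin 7) : casimirDualCoeff α β γ i ≠ 0 := by
  fin_cases i <;> simp [casimirDualCoeff, hα, hβ, hγ]

theorem casimir_eq_form (α β γ : K) : casimir α β γ = Quadric.form (casimirCoeff α β γ) := by
  simp [casimir, Quadric.form, casimirCoeff, Fin.sum_univ_seven]

variable [CharZero K]

theorem poissonEnv_bracket_X (α β γ : K) (i : Fin 7) (g : MvPolynomial (Fin 7) K) :
    (poissonEnv α β γ).bracket (X i) g =
      ∑ j, pderiv j g * (poissonEnv α β γ).bracket (X i) (X j) := by
  change GenericPoisson.envBracket _ _ _ _ =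
    ∑ j, _ * GenericPoisson.envBracket _ _ (X i) (X j)
  simp_rw [GenericPoisson.envBracket_X_X]
  simp [GenericPoisson.envBracket_apply, pderiv_X, Pi.single_apply]

/-- The brackets of the generators of `P(𝕄)`. -/
noncomputable def bracketTable (α β γ : K) : Fin 7 → Fin 7 → MvPolynomial (Fin 7) K :=
  ![![0, X 3, X 6, -(C α * X 1), X 5, -(C α * X 4), -(C α * X 2)],
    ![-X 3, 0, X 4, C β * X 0, -(C β * X 2), C β * X 6, -X 5],
    ![-X 6, -X 4, 0, X 5, C γ * X 1, -(C γ * X 3), C γ * X 0],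
    ![C α * X 1, -(C β * X 0), -X 5, 0, C β * X 6, C α * C β * X 2, -(C α * X 4)],
    ![-X 5, C β * X 2, -(C γ * X 1), -(C β * X 6), 0, C β * C γ * X 0, C γ * X 3],
    ![C α * X 4, -(C β * X 6), C γ * X 3, -(C α * C β * X 2), -(C β * C γ * X 0), 0,
      C α * C γ * X 1],
    ![C α * X 2, X 5, -(C γ * X 0), C α * X 4, -(C γ * X 3), -(C α * C γ * X 1), 0]]

theorem poissonEnv_bracket_X_X (α β γ : K) (i j : Fin 7) :
    (poissonEnv α β γ).bracket (X i) (X j) = bracketTable α β γ i j := by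
  change GenericPoisson.envBracket _ _ (X i) (X j) = _
  rw [GenericPoisson.envBracket_X_X]
  revert j
  fin_cases i <;> intro j <;> fin_cases j <;>
  simp [Fin.sum_univ_seven, GenericPoisson.linPoly, mul, mulFun, bracketTable]

/-- The cross product identity behind the theorem, checked entry by entry on the multiplication
table. -/
theorem sum_bracket_mul_bracket_X (α β γ : K) (k j : Fin 7) :
    ∑ i, C (casimirCoeff α β γ i) * (poissonEnv α β γ).bracket (X k) (X i) *
        (poissonEnv α β γ).bracket (X i) (X j) =
      C (casimirDualCoeff α β γ k) *
        (C (casimirCoeff α β γ k) * X k * X j -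
          if k = j then Quadric.form (casimirCoeff α β γ) else 0) := by
  simp_rw [poissonEnv_bracket_X_X, ← casimir_eq_form, Fin.sum_univ_seven]
  revert j
  fin_cases k <;> intro j <;> fin_cases j <;>
  · simp [casimir, casimirCoeff, casimirDualCoeff, bracketTable]
    try ring

/-- Combining two Hamiltonian derivations gives the tangent derivations of the Casimir quadric. -/
theorem sum_bracket_mul_bracket (α β γ lam : K) (k : Fin 7) (g : MvPolynomial (Fin 7) K) :
    ∑ i, C (casimirCoeff α β γ i) * (poissonEnv α β γ).bracket (X k) (X i) *
        (poissonEnv α β γ).bracket (X i) g =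
      - C (casimirDualCoeff α β γ k) *
        (Quadric.tangent (casimirCoeff α β γ) lam k g +
          pderiv k g * (casimir α β γ - C lam)) := by
  simp_rw [poissonEnv_bracket_X α β γ _ g, Finset.mul_sum]
  rw [Finset.sum_comm]
  have h : ∀ j, ∑ i, C (casimirCoeff α β γ i) * (poissonEnv α β γ).bracket (X k) (X i) *
      (pderiv j g * (poissonEnv α β γ).bracket (X i) (X j)) =
      pderiv j g * (C (casimirDualCoeff α β γ k) *
        (C (casimirCoeff α β γ k) * X k * X j -
          if k = j then Quadric.form (casimirCoeff α β γ) else 0)) := by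
    intro j
    rw [← sum_bracket_mul_bracket_X, Finset.mul_sum]
    exact Finset.sum_congr rfl fun i _ => by ring
  simp_rw [h, mul_sub, mul_ite, mul_zero]
  rw [Finset.sum_sub_distrib, Finset.sum_ite_eq, if_pos (Finset.mem_univ _),
    Quadric.tangent_apply, Quadric.euler_apply, casimir_eq_form]
  have h2 : ∑ j, pderiv j g * (C (casimirDualCoeff α β γ k) *
      (C (casimirCoeff α β γ k) * X k * X j)) = C (casimirDualCoeff α β γ k) *
      (C (casimirCoeff α β γ k) * X k) * ∑ j, X j * pderiv j g := by
    rw [Finset.mul_sum]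
    exact Finset.sum_congr rfl fun j _ => by ring
  rw [h2]
  ring

/-- J need not be a Poisson ideal: only the brackets with g must lie in it. This serves both g in a
Poisson ideal and a lift g of a central element. -/
theorem tangent_mem {α β γ : K} (hα : α ≠ 0) (hβ : β ≠ 0) (hγ : γ ≠ 0) {lam : K}
    {J : Ideal (MvPolynomial (Fin 7) K)} (hF : casimir α β γ - C lam ∈ J)
    {g : MvPolynomial (Fin 7) K} (hg : ∀ a, (poissonEnv α β γ).bracket a g ∈ J) (k : Fin 7) :
    Quadric.tangent (casimirCoeff α β γ) lam k g ∈ J := by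
  refine Quadric.mem_of_C_mul_mem (neg_ne_zero.mpr (casimirDualCoeff_ne_zero hα hβ hγ k)) ?_
  have h1 := J.sum_mem (t := Finset.univ) fun i _ => J.mul_mem_left
    (C (casimirCoeff α β γ i) * (poissonEnv α β γ).bracket (X k) (X i)) (hg (X i))
  rw [sum_bracket_mul_bracket α β γ lam] at h1
  convert J.add_mem h1
    (J.mul_mem_left (C (casimirDualCoeff α β γ k) * pderiv k g) hF) using 1
  rw [C_neg]
  ring

theorem casimirQuotient_isCentral {α β γ : K} (hα : α ≠ 0) (hβ : β ≠ 0) (hγ : γ ≠ 0)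
    {lam : K} (hlam : lam ≠ 0) : (casimirQuotient α β γ lam).IsCentral := by
  set I := Ideal.span {casimir α β γ - C lam} with hI
  have hF : casimir α β γ - C lam ∈ I := Ideal.mem_span_singleton_self _
  apply Set.Subset.antisymm
  · intro z hz
    obtain ⟨z, rfl⟩ := Ideal.Quotient.mk_surjective z
    have h1 : ∀ a, (poissonEnv α β γ).bracket a z ∈ I := by
      intro a
      rw [GenericPoisson.skew, neg_mem_iff, ← Ideal.Quotient.eq_zero_iff_mem]
      exact hz (Ideal.Quotient.mk I a)
    have h2 := tangent_mem hα hβ hγ hF h1 0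
    rw [hI, casimir_eq_form] at h2
    obtain ⟨t, ht⟩ :=
      Quadric.exists_sub_C_mem_of_tangent_mem (casimirCoeff_ne_zero hα hβ hγ) hlam h2
    rw [← casimir_eq_form] at ht
    exact ⟨t, (Ideal.Quotient.eq.mpr ht).symm⟩
  · rintro _ ⟨t, rfl⟩ a
    have h1 : (casimirQuotient α β γ lam).bracket a 1 = 0 := by
      simpa using (casimirQuotient α β γ lam).leibniz a 1 1
    rw [Algebra.algebraMap_eq_smul_one, GenericPoisson.skew, map_smul, h1, smul_zero, neg_zero]

theorem casimirQuotient_isSimple {α β γ : K} (hα : α ≠ 0) (hβ : β ≠ 0) (hγ : γ ≠ 0)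
    {lam : K} (hlam : lam ≠ 0) : (casimirQuotient α β γ lam).IsSimple := by
  have hq := casimirCoeff_ne_zero hα hβ hγ
  constructor
  · refine Ideal.Quotient.nontrivial_iff.mpr fun h => ?_
    -- 1 is written as the normal form 1 + 0 · X₀, so uniqueness keeps it out of the ideal.
    have h1 : Quadric.tailMap 1 + Quadric.tailMap 0 * X 0 ∈
        Ideal.span {Quadric.form (casimirCoeff α β γ) - C lam} := by
      rw [← casimir_eq_form, h]
      exact Submodule.mem_top
    exact one_ne_zero (Quadric.eq_zero_of_normal_form_mem (hq 0) h1).1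
  · intro I hI
    set π := Ideal.Quotient.mk (Ideal.span {casimir α β γ - C lam}) with hπ
    have hsurj : Function.Surjective π := Ideal.Quotient.mk_surjective
    have hF : casimir α β γ - C lam ∈ I.comap π := by
      rw [Ideal.mem_comap, Ideal.Quotient.eq_zero_iff_mem.mpr (Ideal.mem_span_singleton_self _)]
      exact I.zero_mem
    have hJ : ∀ k, ∀ g ∈ I.comap π,
        Quadric.tangent (casimirCoeff α β γ) lam k g ∈ I.comap π :=
      fun k g hg => tangent_mem hα hβ hγ hF (fun a => hI (π a) (π g) hg) k
    have hF' : Quadric.form (casimirCoeff α β γ) - C lam ∈ I.comap π := casimir_eq_form α β γ ▸ hF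
    rcases Quadric.eq_span_or_eq_top hq hlam hF' hJ with h | h
    · left
      rw [← Ideal.map_comap_of_surjective π hsurj I, h, ← casimir_eq_form, hπ,
        Ideal.map_quotient_self]
    · right
      rw [← Ideal.map_comap_of_surjective π hsurj I, h, Ideal.map_top]

end Malcev

theorem theorem2 {K : Type*} [Field K] [CharZero K] (α β γ : K)
    (hα : α ≠ 0) (hβ : β ≠ 0) (hγ : γ ≠ 0) (lam : K) (hlam : lam ≠ 0) :
    (Malcev.casimirQuotient α β γ lam).IsCentral ∧
      (Malcev.casimirQuotient α β γ lam).IsSimple :=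
  ⟨Malcev.casimirQuotient_isCentral hα hβ hγ hlam, Malcev.casimirQuotient_isSimple hα hβ hγ hlam⟩
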